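/- Let $\alpha=\sqrt[3]{2}\in\mathbb R$, and in the variables $\mathbf x=(x_0,x_1,x_2,x_3)$, $\mathbf y=(y_0,y_1,y_2,y_3)$ put \begin{align*} p_1&=(-4\alpha^2+4\alpha-2)x_0^2+x_1^2-2x_1x_2+2x_2x_3-2x_3^2,\\ p_2&=(-4\alpha^2-4\alpha+6)x_0^2+x_1^2+2x_1x_2+2x_2x_3+2x_3^2,\\ p_3&=4\alpha x_0x_1+4x_0x_2+4\alpha^2x_0x_3,\\ q_1&=y_0^2-y_3^2,\qquad q_2=y_1^2-y_3^2,\qquad q_3=y_2^2-y_3^2,\\ q_4&=-y_0^2-y_0y_1-y_0y_2+y_0y_3-y_1y_2+y_1y_3+y_2y_3, \end{align*} $f=p_1^2+p_2^2+p_3^2$, $g=q_1^2+q_2^2+q_3^2+q_4^2$, $r=x_2^2-y_2^2$ and $$h(\mathbf x,\mathbf y)=f(\mathbf x)+g(\mathbf y)+r(x_2,y_2)^2 .$$ Theorem. The polynomial $h$ is a quartic form in eight variables with rational coefficients; explicitly \begin{align*} f={}&40x_0^4+8x_0^2x_1^2+32x_0^2x_1x_2+64x_0^2x_1x_3+16x_0^2x_2^2+16x_0^2x_2x_3+32x_0^2x_3^2\\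 &+2x_1^4+8x_1^2x_2^2+8x_1^2x_2x_3+16x_1x_2x_3^2+8x_2^2x_3^2+8x_3^4 . \end{align*} It is strictly positive, that is, $h(v)>0$ for every $v\in\mathbb R^8\setminus\{0\}$. It is a sum of squares of polynomials in $\mathbb Q(\sqrt[3]{2})[\mathbf x,\mathbf y]$ (hence also in $\mathbb R[\mathbf x,\mathbf y]$), but it is not a sum of squares of polynomials in $\mathbb Q[\mathbf x,\mathbf y]$. In particular, there is a strictly positive form with rational coefficients that is a sum of squares of polynomials over $\mathbb R$ but not over $\mathbb Q$, which answers a question of C. Scheiderer. -/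

import Mathlib

open MvPolynomial

noncomputable section

namespace StrictlyPositiveSOS

/-- The index set of the eight variables `x₀, x₁, x₂, x₃, y₀, y₁, y₂, y₃`. -/
abbrev Vars : Type := Fin 4 ⊕ Fin 4

/-- The variable `xᵢ` of `R[x₀, …, x₃, y₀, …, y₃]`. -/
def x (R : Type) [CommRing R] (i : Fin 4) : MvPolynomial Vars R := X (Sum.inl i)

/-- The variable `yᵢ` of `R[x₀, …, x₃, y₀, …, y₃]`. -/
def y (R : Type) [CommRing R] (i : Fin 4) : MvPolynomial Vars R := X (Sum.inr i)

/-- The real cube root of `2`. -/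
def cbrtTwo : ℝ := (2 : ℝ) ^ (1 / 3 : ℝ)

/-- The field `ℚ(∛2)`, as a subfield of `ℝ`. -/
abbrev K : IntermediateField ℚ ℝ := IntermediateField.adjoin ℚ {cbrtTwo}

/-- The element `∛2` of the field `ℚ(∛2)`. -/
def α : K := IntermediateField.AdjoinSimple.gen ℚ cbrtTwo

def p₁ : MvPolynomial Vars K :=
  C (-4 * α ^ 2 + 4 * α - 2) * x K 0 ^ 2 + x K 1 ^ 2 - 2 * x K 1 * x K 2
    + 2 * x K 2 * x K 3 - 2 * x K 3 ^ 2

def p₂ : MvPolynomial Vars K :=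
  C (-4 * α ^ 2 - 4 * α + 6) * x K 0 ^ 2 + x K 1 ^ 2 + 2 * x K 1 * x K 2
    + 2 * x K 2 * x K 3 + 2 * x K 3 ^ 2

def p₃ : MvPolynomial Vars K :=
  C (4 * α) * x K 0 * x K 1 + 4 * x K 0 * x K 2 + C (4 * α ^ 2) * x K 0 * x K 3

/-- The quartic `f = p₁² + p₂² + p₃²`, defined over `ℚ(∛2)`. -/
def f : MvPolynomial Vars K := p₁ ^ 2 + p₂ ^ 2 + p₃ ^ 2

/-- The expanded form of `f`, with rational coefficients. -/
def fRat : MvPolynomial Vars ℚ :=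
  40 * x ℚ 0 ^ 4 + 8 * x ℚ 0 ^ 2 * x ℚ 1 ^ 2 + 32 * x ℚ 0 ^ 2 * x ℚ 1 * x ℚ 2
    + 64 * x ℚ 0 ^ 2 * x ℚ 1 * x ℚ 3 + 16 * x ℚ 0 ^ 2 * x ℚ 2 ^ 2
    + 16 * x ℚ 0 ^ 2 * x ℚ 2 * x ℚ 3 + 32 * x ℚ 0 ^ 2 * x ℚ 3 ^ 2
    + 2 * x ℚ 1 ^ 4 + 8 * x ℚ 1 ^ 2 * x ℚ 2 ^ 2 + 8 * x ℚ 1 ^ 2 * x ℚ 2 * x ℚ 3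
    + 16 * x ℚ 1 * x ℚ 2 * x ℚ 3 ^ 2 + 8 * x ℚ 2 ^ 2 * x ℚ 3 ^ 2 + 8 * x ℚ 3 ^ 4

def q₁ (R : Type) [CommRing R] : MvPolynomial Vars R := y R 0 ^ 2 - y R 3 ^ 2

def q₂ (R : Type) [CommRing R] : MvPolynomial Vars R := y R 1 ^ 2 - y R 3 ^ 2

def q₃ (R : Type) [CommRing R] : MvPolynomial Vars R := y R 2 ^ 2 - y R 3 ^ 2

def q₄ (R : Type) [CommRing R] : MvPolynomial Vars R :=
  -y R 0 ^ 2 - y R 0 * y R 1 - y R 0 * y R 2 + y R 0 * y R 3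
    - y R 1 * y R 2 + y R 1 * y R 3 + y R 2 * y R 3

/-- The quartic `g = q₁² + q₂² + q₃² + q₄²`. -/
def g (R : Type) [CommRing R] : MvPolynomial Vars R :=
  q₁ R ^ 2 + q₂ R ^ 2 + q₃ R ^ 2 + q₄ R ^ 2

/-- The quadratic form `r = x₂² - y₂²`. -/
def r (R : Type) [CommRing R] : MvPolynomial Vars R := x R 2 ^ 2 - y R 2 ^ 2

/-- The octonary quartic `h = f + g + r²`, where `f = p₁² + p₂² + p₃²`, over `ℚ(∛2)`. -/
def h : MvPolynomial Vars K := f + g K + r K ^ 2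

/-- The polynomial `f + g + r²` over `ℚ`, with `f` in expanded form. -/
def hRat : MvPolynomial Vars ℚ := fRat + g ℚ + r ℚ ^ 2

end StrictlyPositiveSOS

end

namespace StrictlyPositiveSOS

/-! ### The polynomials over `ℚ(∛2)` and over `ℝ` -/

/-! Positivity: `g` vanishes only at 0, then `r = 0` forces `x₂ = 0`, and `f` has no nonzero real
zero with `x₂ = 0`.

Non-representability over `ℚ`: suppose `h = ∑ Qᵢ²`, where the `Qᵢ` may be taken to be rational
quadratic forms. Let `a` be a real zero of `f` with `a₂² = 1`. On the cube vertices `(a, (±1, ±1,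
±1, 1))`, `h` reduces to `q₄²`, and the values of `q₄` are extremal for the linear relation that
every quadratic form satisfies on a cube. This forces each `Qᵢ(a, 0)` to be a combination of values
of `Qᵢ` on the `y`-space that does not depend on `a` (`quad_elim_zero_eq`). Hence `Qᵢ` agrees at the
rational zero `(0, 0, 1, 0)` and the irrational zero `(0, -t², 1, -t)`, where `t = ∛2`. As `1, t,
t²` are independent over `ℚ`, the restriction of `Qᵢ` to `x₀ = 0`, `y = 0` lies in the span of `x₁²
+ 2x₂x₃`, `x₁x₂ + x₃²` and `x₂²` (`quad_hyperplane_eq`). Comparing the terms of `h` divisible by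
exactly `x₀²` then gives a psd ternary form with rational parameters `ξ, τ`, although psd-ness
forces `τ³ = 2` (`not_forall_ternary_nonneg`). -/

lemma cbrtTwo_pow_three : cbrtTwo ^ 3 = 2 := by
  unfold cbrtTwo
  rw [← Real.rpow_natCast, ← Real.rpow_mul (by norm_num)]
  norm_num

lemma alpha_pow_three : α ^ 3 = 2 := by
  apply Subtype.ext
  exact cbrtTwo_pow_three.trans (map_ofNat (algebraMap K ℝ) 2).symm

lemma map_hRat : MvPolynomial.map (algebraMap ℚ K) hRat = h := by
  have hα : (C α : MvPolynomial Vars K) ^ 3 = 2 := by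
    rw [← map_pow, alpha_pow_three, map_ofNat]
  simp only [hRat, h, fRat, f, p₁, p₂, p₃, g, r, q₁, q₂, q₃, q₄, x, y, map_add, map_sub, map_mul,
    map_neg, map_pow, map_ofNat, MvPolynomial.map_X]
  -- The difference of the two sides is a multiple of `α³ - 2`; the coefficient is the quotient.
  linear_combination (-(32 * C α * X (Sum.inl 0) ^ 4
    + 16 * C α * X (Sum.inl 0) ^ 2 * X (Sum.inl 3) ^ 2
    + 32 * X (Sum.inl 0) ^ 2 * X (Sum.inl 1) * X (Sum.inl 3)) : MvPolynomial Vars K) * hα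

lemma isSumSq_h : IsSumSq h := by
  have hsq (p : MvPolynomial Vars K) : IsSumSq (p ^ 2) := by
    rw [sq]; exact .mul_self p
  exact ((((hsq _).add (hsq _)).add (hsq _)).add
    ((((hsq _).add (hsq _)).add (hsq _)).add (hsq _))).add (hsq _)

lemma isSumSq_map {R S : Type*} [Semiring R] [Semiring S] (φ : R →+* S) {a : R}
    (ha : IsSumSq a) : IsSumSq (φ a) := by
  induction ha with
  | zero => simp
  | sq_add b _ ih => rw [map_add, map_mul]; exact .sq_add _ ih

lemma isSumSq_map_real : IsSumSq (MvPolynomial.map (algebraMap ℚ ℝ) hRat) := by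
  rw [IsScalarTower.algebraMap_eq ℚ K ℝ, ← MvPolynomial.map_map, map_hRat]
  exact isSumSq_map _ isSumSq_h

lemma isHomogeneous_hRat : hRat.IsHomogeneous 4 := by
  have hx (i : Fin 4) : (x ℚ i).IsHomogeneous 1 := isHomogeneous_X _ _
  have hy (i : Fin 4) : (y ℚ i).IsHomogeneous 1 := isHomogeneous_X _ _
  have hn (n : ℕ) [n.AtLeastTwo] :
      (OfNat.ofNat n : MvPolynomial Vars ℚ).IsHomogeneous 0 := by
    rw [← map_ofNat C]; exact isHomogeneous_C _ _
  have hf : fRat.IsHomogeneous 4 := by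
    unfold fRat
    refine .add (.add (.add (.add (.add (.add (.add (.add (.add (.add (.add (.add ?_ ?_) ?_) ?_) ?_)
      ?_) ?_) ?_) ?_) ?_) ?_) ?_) ?_
    · exact (hn 40).mul ((hx 0).pow 4)
    · exact ((hn 8).mul ((hx 0).pow 2)).mul ((hx 1).pow 2)
    · exact (((hn 32).mul ((hx 0).pow 2)).mul (hx 1)).mul (hx 2)
    · exact (((hn 64).mul ((hx 0).pow 2)).mul (hx 1)).mul (hx 3)
    · exact ((hn 16).mul ((hx 0).pow 2)).mul ((hx 2).pow 2)
    · exact (((hn 16).mul ((hx 0).pow 2)).mul (hx 2)).mul (hx 3)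
    · exact ((hn 32).mul ((hx 0).pow 2)).mul ((hx 3).pow 2)
    · exact (hn 2).mul ((hx 1).pow 4)
    · exact ((hn 8).mul ((hx 1).pow 2)).mul ((hx 2).pow 2)
    · exact (((hn 8).mul ((hx 1).pow 2)).mul (hx 2)).mul (hx 3)
    · exact (((hn 16).mul (hx 1)).mul (hx 2)).mul ((hx 3).pow 2)
    · exact ((hn 8).mul ((hx 2).pow 2)).mul ((hx 3).pow 2)
    · exact (hn 8).mul ((hx 3).pow 4)
  have hq₄ : (q₄ ℚ).IsHomogeneous 2 := by
    unfold q₄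
    have hyy (i j : Fin 4) : (y ℚ i * y ℚ j).IsHomogeneous 2 := (hy i).mul (hy j)
    exact .add (.add (.sub (.add (.sub (.sub (.neg ((hy 0).pow 2)) (hyy 0 1)) (hyy 0 2)) (hyy 0 3))
      (hyy 1 2)) (hyy 1 3)) (hyy 2 3)
  have hd {a b : MvPolynomial Vars ℚ} (ha : a.IsHomogeneous 1) (hb : b.IsHomogeneous 1) :
      ((a ^ 2 - b ^ 2) ^ 2).IsHomogeneous 4 := ((ha.pow 2).sub (hb.pow 2)).pow 2
  exact (hf.add ((((hd (hy 0) (hy 3)).add (hd (hy 1) (hy 3))).add (hd (hy 2) (hy 3))).add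
    (hq₄.pow 2))).add (hd (hx 2) (hy 2))

/-! ### Strict positivity -/

/-- The value of `f` at a real point. -/
def fVal (x : Fin 4 → ℝ) : ℝ :=
  40 * x 0 ^ 4 + 8 * x 0 ^ 2 * x 1 ^ 2 + 32 * x 0 ^ 2 * x 1 * x 2
    + 64 * x 0 ^ 2 * x 1 * x 3 + 16 * x 0 ^ 2 * x 2 ^ 2
    + 16 * x 0 ^ 2 * x 2 * x 3 + 32 * x 0 ^ 2 * x 3 ^ 2
    + 2 * x 1 ^ 4 + 8 * x 1 ^ 2 * x 2 ^ 2 + 8 * x 1 ^ 2 * x 2 * x 3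
    + 16 * x 1 * x 2 * x 3 ^ 2 + 8 * x 2 ^ 2 * x 3 ^ 2 + 8 * x 3 ^ 4

/-- The value of `g` at a real point. -/
def gVal (y : Fin 4 → ℝ) : ℝ :=
  (y 0 ^ 2 - y 3 ^ 2) ^ 2 + (y 1 ^ 2 - y 3 ^ 2) ^ 2 + (y 2 ^ 2 - y 3 ^ 2) ^ 2
    + (-y 0 ^ 2 - y 0 * y 1 - y 0 * y 2 + y 0 * y 3 - y 1 * y 2 + y 1 * y 3 + y 2 * y 3) ^ 2

lemma aeval_hRat (a b : Fin 4 → ℝ) :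
    aeval (Sum.elim a b) hRat = fVal a + gVal b + (a 2 ^ 2 - b 2 ^ 2) ^ 2 := by
  simp [hRat, fRat, g, r, q₁, q₂, q₃, q₄, x, y, fVal, gVal]

/-- From `p₁² + p₂² = 2((p₁ + p₂)/2)² + 2((p₂ - p₁)/2)²`, which separates the three quadrics whose
common zeros are the zeros of `f`. -/
lemma fVal_eq {t : ℝ} (ht : t ^ 3 = 2) (x : Fin 4 → ℝ) :
    fVal x = 2 * (x 1 ^ 2 + 2 * x 2 * x 3 - (4 * t ^ 2 - 2) * x 0 ^ 2) ^ 2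
      + 8 * (x 1 * x 2 + x 3 ^ 2 - 2 * (t - 1) * x 0 ^ 2) ^ 2
      + 16 * (x 0 * (t * x 1 + x 2 + t ^ 2 * x 3)) ^ 2 := by
  unfold fVal
  linear_combination (-(32 * t * x 0 ^ 4 + 16 * t * x 0 ^ 2 * x 3 ^ 2
    + 32 * x 0 ^ 2 * x 1 * x 3)) * ht

lemma fVal_nonneg (x : Fin 4 → ℝ) : 0 ≤ fVal x := by
  rw [fVal_eq cbrtTwo_pow_three]; positivity

lemma gVal_nonneg (y : Fin 4 → ℝ) : 0 ≤ gVal y := by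
  unfold gVal; positivity

lemma eq_zero_of_gVal_eq_zero {y : Fin 4 → ℝ} (hy : gVal y = 0) : y = 0 := by
  unfold gVal at hy
  set A := y 0 ^ 2 - y 3 ^ 2 with hA
  set B := y 1 ^ 2 - y 3 ^ 2 with hB
  set D := y 2 ^ 2 - y 3 ^ 2 with hD
  set Q := -y 0 ^ 2 - y 0 * y 1 - y 0 * y 2 + y 0 * y 3 - y 1 * y 2 + y 1 * y 3 + y 2 * y 3 with hQ
  have zA : A = 0 := by
    rw [← pow_eq_zero_iff two_ne_zero]
    linarith [sq_nonneg A, sq_nonneg B, sq_nonneg D, sq_nonneg Q]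
  have zB : B = 0 := by
    rw [← pow_eq_zero_iff two_ne_zero]
    linarith [sq_nonneg A, sq_nonneg B, sq_nonneg D, sq_nonneg Q]
  have zD : D = 0 := by
    rw [← pow_eq_zero_iff two_ne_zero]
    linarith [sq_nonneg A, sq_nonneg B, sq_nonneg D, sq_nonneg Q]
  have zQ : Q = 0 := by
    rw [← pow_eq_zero_iff two_ne_zero]
    linarith [sq_nonneg A, sq_nonneg B, sq_nonneg D, sq_nonneg Q]
  have h0 := sq_eq_sq_iff_eq_or_eq_neg.1 (sub_eq_zero.1 (hA ▸ zA))
  have h1 := sq_eq_sq_iff_eq_or_eq_neg.1 (sub_eq_zero.1 (hB ▸ zB))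
  have h2 := sq_eq_sq_iff_eq_or_eq_neg.1 (sub_eq_zero.1 (hD ▸ zD))
  rw [hQ] at zQ
  -- Now `yᵢ = ±y₃` for `i < 3`, and for each choice of signs `Q` equals `±y₃²` or `-7y₃²`.
  have h3 : y 3 = 0 := by
    apply pow_eq_zero_iff two_ne_zero |>.1
    rcases h0 with h0 | h0 <;> rcases h1 with h1 | h1 <;> rcases h2 with h2 | h2 <;>
      rw [h0, h1, h2] at zQ <;> linarith
  simp only [h3, neg_zero, or_self] at h0 h1 h2
  funext i; fin_cases i <;> assumption

lemma cbrtTwo_bounds : 1.25 < cbrtTwo ∧ cbrtTwo < 1.26 := by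
  have h := cbrtTwo_pow_three
  have h0 : 0 < cbrtTwo := by unfold cbrtTwo; positivity
  constructor
  · exact lt_of_pow_lt_pow_left₀ 3 h0.le (by rw [h]; norm_num)
  · exact lt_of_pow_lt_pow_left₀ 3 (by norm_num) (by rw [h]; norm_num)

lemma eq_zero_of_fVal_eq_zero {x : Fin 4 → ℝ} (h2 : x 2 = 0) (hx : fVal x = 0) : x = 0 := by
  obtain ⟨hl, hu⟩ := cbrtTwo_bounds
  have hx' := hx
  rw [fVal_eq cbrtTwo_pow_three, h2] at hx'
  set t := cbrtTwo
  have e1 : x 3 ^ 2 = 2 * (t - 1) * x 0 ^ 2 := by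
    rw [← sub_eq_zero, ← pow_eq_zero_iff two_ne_zero]
    nlinarith [sq_nonneg (x 1 ^ 2 - (4 * t ^ 2 - 2) * x 0 ^ 2),
      sq_nonneg (x 0 * (t * x 1 + t ^ 2 * x 3)), sq_nonneg (x 3 ^ 2 - 2 * (t - 1) * x 0 ^ 2)]
  have e2 : x 1 ^ 2 = (4 * t ^ 2 - 2) * x 0 ^ 2 := by
    rw [← sub_eq_zero, ← pow_eq_zero_iff two_ne_zero]
    nlinarith [sq_nonneg (x 1 ^ 2 - (4 * t ^ 2 - 2) * x 0 ^ 2),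
      sq_nonneg (x 0 * (t * x 1 + t ^ 2 * x 3)), sq_nonneg (x 3 ^ 2 - 2 * (t - 1) * x 0 ^ 2)]
  have e3 : x 0 * (t * x 1 + t ^ 2 * x 3) = 0 := by
    rw [← pow_eq_zero_iff two_ne_zero]
    nlinarith [sq_nonneg (x 1 ^ 2 - (4 * t ^ 2 - 2) * x 0 ^ 2),
      sq_nonneg (x 0 * (t * x 1 + t ^ 2 * x 3)), sq_nonneg (x 3 ^ 2 - 2 * (t - 1) * x 0 ^ 2)]
  have h0 : x 0 = 0 := by
    rcases mul_eq_zero.1 e3 with h | h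
    · exact h
    have h' : x 1 = -(t * x 3) := by
      have : t * (x 1 + t * x 3) = 0 := by linear_combination h
      rcases mul_eq_zero.1 this with h | h <;> linarith
    -- By `t³ = 2` the coefficient is `6(t² - 1)`, which is positive.
    have e4 : (4 * t ^ 2 - 2 - 2 * t ^ 2 * (t - 1)) * x 0 ^ 2 = 0 := by
      rw [h'] at e2; linear_combination t ^ 2 * e1 - e2
    rcases mul_eq_zero.1 e4 with h | h
    · nlinarith [cbrtTwo_pow_three]
    · exact pow_eq_zero_iff two_ne_zero |>.1 h
  rw [h0] at e1 e2
  funext i; fin_cases i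
  · exact h0
  · exact pow_eq_zero_iff two_ne_zero |>.1 (e2.trans (by ring))
  · exact h2
  · exact pow_eq_zero_iff two_ne_zero |>.1 (e1.trans (by ring))

lemma aeval_hRat_pos {v : Vars → ℝ} (hv : v ≠ 0) : 0 < aeval v hRat := by
  obtain ⟨a, b, rfl⟩ : ∃ a b, v = Sum.elim a b :=
    ⟨_, _, (Sum.elim_comp_inl_inr v).symm⟩
  rw [aeval_hRat]
  have hf := fVal_nonneg a
  have hg := gVal_nonneg b
  have hr := sq_nonneg (a 2 ^ 2 - b 2 ^ 2)
  refine lt_of_le_of_ne (by positivity) fun h0 => hv ?_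
  have hb : b = 0 := eq_zero_of_gVal_eq_zero (by linarith)
  have ha2 : a 2 = 0 := by
    have : (a 2 ^ 2 - b 2 ^ 2) ^ 2 = 0 := by linarith
    simpa [hb] using this
  have ha : a = 0 := eq_zero_of_fVal_eq_zero ha2 (by linarith)
  subst ha hb
  funext i; cases i <;> rfl

/-! ### Sums of squares of forms -/

lemma _root_.IsSumSq.exists_fin_sum {R : Type*} [CommSemiring R] {a : R} (ha : IsSumSq a) :
    ∃ (n : ℕ) (s : Fin n → R), a = ∑ i, s i ^ 2 := by
  induction ha with
  | zero => exact ⟨0, Fin.elim0, by simp⟩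
  | sq_add b _ ih =>
    obtain ⟨n, s, rfl⟩ := ih
    exact ⟨n + 1, Fin.cons b s, by simp [Fin.sum_univ_succ, sq]⟩

lemma homogeneousComponent_mul {σ R : Type*} [CommSemiring R] (n : ℕ) (p q : MvPolynomial σ R) :
    homogeneousComponent n (p * q)
      = ∑ ij ∈ Finset.HasAntidiagonal.antidiagonal n,
          homogeneousComponent ij.1 p * homogeneousComponent ij.2 q := by
  classical
  let _ := MvPolynomial.gradedAlgebra (σ := σ) (R := R)
  have hdec (φ : MvPolynomial σ R) (i : ℕ) :
      (DirectSum.decompose (homogeneousSubmodule σ R) φ i : MvPolynomial σ R)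
        = homogeneousComponent i φ := decomposition.decompose'_apply φ i
  simp only [← hdec]
  rw [DirectSum.decompose_mul, DirectSum.coe_mul_apply_eq_sum_antidiagonal]

lemma eq_zero_of_sum_sq_eq_zero {σ ι : Type*} [Fintype ι] {s : ι → MvPolynomial σ ℚ}
    (hs : ∑ i, s i ^ 2 = 0) (i : ι) : s i = 0 := by
  apply MvPolynomial.funext
  intro v
  have h := congrArg (eval v) hs
  simp only [map_sum, map_pow, map_zero] at h
  have := (Finset.sum_eq_zero_iff_of_nonneg (fun i _ => sq_nonneg (eval v (s i)))).1 h i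
    (Finset.mem_univ i)
  simpa using this

/-- If a quartic form over `ℚ` is a sum of squares, it is the sum of the squares of the quadratic
components of the summands. -/
lemma eq_sum_sq_homogeneousComponent {σ ι : Type*} [Fintype ι] {p : MvPolynomial σ ℚ}
    (hp : p.IsHomogeneous 4) {s : ι → MvPolynomial σ ℚ} (hs : p = ∑ i, s i ^ 2) :
    p = ∑ i, homogeneousComponent 2 (s i) ^ 2 := by
  have hcomp (n : ℕ) : homogeneousComponent n p = ∑ i, ∑ ij ∈ Finset.HasAntidiagonal.antidiagonal n,
      homogeneousComponent ij.1 (s i) * homogeneousComponent ij.2 (s i) := by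
    rw [hs, map_sum]
    simp only [sq, homogeneousComponent_mul]
  -- The low-degree parts are removed from the bottom up: degree 0 of `p` kills the constant terms,
  -- then degree 2 kills the linear parts. In degree 4 only the products of two quadratic parts
  -- survive.
  have h0 : ∀ i, homogeneousComponent 0 (s i) = 0 := by
    apply eq_zero_of_sum_sq_eq_zero
    have := hcomp 0
    rw [homogeneousComponent_of_mem hp] at this
    simpa [← sq] using this.symm
  have h1 : ∀ i, homogeneousComponent 1 (s i) = 0 := by
    apply eq_zero_of_sum_sq_eq_zero
    have := hcomp 2
    rw [homogeneousComponent_of_mem hp] at this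
    simpa [Finset.Nat.antidiagonal_succ, h0, ← sq] using this.symm
  have := hcomp 4
  rw [homogeneousComponent_of_mem hp] at this
  simpa [Finset.Nat.antidiagonal_succ, h0, h1, ← sq] using this

/-- The value at a real point of the quadratic form with matrix `M`. -/
def quad (M : Vars → Vars → ℚ) (v : Vars → ℝ) : ℝ := ∑ j, ∑ k, M j k * v j * v k

lemma exists_aeval_eq_sum {p : MvPolynomial Vars ℚ} (hp : p.IsHomogeneous 1) :
    ∃ L : Vars → ℚ, ∀ v : Vars → ℝ, aeval v p = ∑ j, L j * v j := by
  rw [← mem_homogeneousSubmodule, homogeneousSubmodule_one_eq_span_X] at hp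
  induction hp using Submodule.span_induction with
  | mem _ h =>
    obtain ⟨j, rfl⟩ := h
    exact ⟨fun k => if k = j then 1 else 0, fun v => by
      rw [aeval_X, Finset.sum_eq_single j] <;> simp +contextual [-Fintype.sum_sum_type]⟩
  | zero => exact ⟨0, by simp⟩
  | add _ _ _ _ hp hq =>
    obtain ⟨L, hL⟩ := hp
    obtain ⟨L', hL'⟩ := hq
    exact ⟨L + L', fun v => by simp [hL, hL', add_mul, Finset.sum_add_distrib]⟩
  | smul c _ _ hp =>
    obtain ⟨L, hL⟩ := hp
    exact ⟨c • L, fun v => by simp [hL, Finset.mul_sum, mul_assoc, Rat.smul_def]⟩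

lemma exists_aeval_eq_quad {p : MvPolynomial Vars ℚ} (hp : p.IsHomogeneous 2) :
    ∃ M : Vars → Vars → ℚ, ∀ v : Vars → ℝ, aeval v p = quad M v := by
  rw [← mem_homogeneousSubmodule, ← homogeneousSubmodule_one_pow, sq] at hp
  induction hp using Submodule.mul_induction_on' with
  | mem_mul_mem a ha b hb =>
    obtain ⟨L, hL⟩ := exists_aeval_eq_sum ha
    obtain ⟨L', hL'⟩ := exists_aeval_eq_sum hb
    refine ⟨fun j k => L j * L' k, fun v => ?_⟩
    rw [map_mul, hL, hL', Finset.sum_mul_sum]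
    refine Finset.sum_congr rfl fun j _ => Finset.sum_congr rfl fun k _ => ?_
    push_cast; ring
  | add _ _ _ _ hp hq =>
    obtain ⟨M, hM⟩ := hp
    obtain ⟨M', hM'⟩ := hq
    exact ⟨M + M', fun v => by simp [hM, hM', quad, add_mul, Finset.sum_add_distrib]⟩

lemma quad_add_add_quad_sub (M : Vars → Vars → ℚ) (u w : Vars → ℝ) :
    quad M (u + w) + quad M (u - w) = 2 * quad M u + 2 * quad M w := by
  simp only [quad, Finset.mul_sum, ← Finset.sum_add_distrib, Pi.add_apply, Pi.sub_apply]
  refine Finset.sum_congr rfl fun j _ => Finset.sum_congr rfl fun k _ => ?_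
  ring

/-! ### The values of a quadratic form on the vertices of a cube -/

/-- The point `(a, (e₀, e₁, e₂, 1))`. -/
def pt (a : Fin 4 → ℝ) (e₀ e₁ e₂ : ℝ) : Vars → ℝ := Sum.elim a ![e₀, e₁, e₂, 1]

/-- A polynomial of degree at most 2 has vanishing third mixed difference, so its alternating sum
over the vertices of a cube is zero. -/
lemma quad_cube (M : Vars → Vars → ℚ) (a : Fin 4 → ℝ) :
    quad M (pt a (-1) (-1) (-1)) = quad M (pt a 1 1 1)
      - quad M (pt a (-1) 1 1) - quad M (pt a 1 (-1) 1) - quad M (pt a 1 1 (-1))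
      + quad M (pt a (-1) (-1) 1) + quad M (pt a (-1) 1 (-1)) + quad M (pt a 1 (-1) (-1)) := by
  simp only [quad, pt, Fintype.sum_sum_type, Fin.sum_univ_four, Sum.elim_inl, Sum.elim_inr,
    Matrix.cons_val]
  ring

/-- Cauchy–Schwarz with remainder: by Lagrange's identity the right side is a sum of 21 squares, one
for each pair among `v₁, …, v₇`. The left side is one of them, and the other 20 are discarded. -/
lemma sq_add_le_of_alternating (v₁ v₂ v₃ v₄ v₅ v₆ v₇ v₈ : ℝ)
    (h : v₈ = v₁ - v₂ - v₃ - v₄ + v₅ + v₆ + v₇) :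
    (v₂ + v₅) ^ 2 ≤ 7 * (v₁ ^ 2 + v₂ ^ 2 + v₃ ^ 2 + v₄ ^ 2 + v₅ ^ 2 + v₆ ^ 2 + v₇ ^ 2)
      - v₈ ^ 2 := by
  subst h
  linarith [sq_nonneg (v₁ + v₂), sq_nonneg (v₁ + v₃), sq_nonneg (v₁ + v₄), sq_nonneg (v₁ - v₅),
    sq_nonneg (v₁ - v₆), sq_nonneg (v₁ - v₇), sq_nonneg (v₂ - v₃), sq_nonneg (v₂ - v₄),
    sq_nonneg (v₂ + v₆), sq_nonneg (v₂ + v₇), sq_nonneg (v₃ - v₄), sq_nonneg (v₃ + v₅),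
    sq_nonneg (v₃ + v₆), sq_nonneg (v₃ + v₇), sq_nonneg (v₄ + v₅), sq_nonneg (v₄ + v₆),
    sq_nonneg (v₄ + v₇), sq_nonneg (v₅ - v₆), sq_nonneg (v₅ - v₇), sq_nonneg (v₆ - v₇)]

lemma aeval_pt {a : Fin 4 → ℝ} (ha : fVal a = 0) (ha2 : a 2 ^ 2 = 1) {e₀ e₁ e₂ : ℝ}
    (h₀ : e₀ ^ 2 = 1) (h₁ : e₁ ^ 2 = 1) (h₂ : e₂ ^ 2 = 1) :
    aeval (pt a e₀ e₁ e₂) hRat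
      = (-1 - e₀ * e₁ - e₀ * e₂ + e₀ - e₁ * e₂ + e₁ + e₂) ^ 2 := by
  rw [pt, aeval_hRat, ha, ha2]
  simp [gVal, h₀, h₁, h₂]

section representation

variable {ι : Type*} [Fintype ι] {M : ι → Vars → Vars → ℚ}

/-- Over a real zero of `f`, the summands of `h` are proportional to `q₄` on the vertices of the
cube; in particular they take opposite values at `(-1, 1, 1, 1)` and `(-1, -1, 1, 1)`. -/
lemma quad_pt_add_quad_pt (hM : ∀ v : Vars → ℝ, aeval v hRat = ∑ i, quad (M i) v ^ 2)
    {a : Fin 4 → ℝ} (ha : fVal a = 0) (ha2 : a 2 ^ 2 = 1) (i : ι) :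
    quad (M i) (pt a (-1) 1 1) + quad (M i) (pt a (-1) (-1) 1) = 0 := by
  have hval {e₀ e₁ e₂ : ℝ} (h₀ : e₀ ^ 2 = 1) (h₁ : e₁ ^ 2 = 1) (h₂ : e₂ ^ 2 = 1) :=
    (hM _).symm.trans (aeval_pt ha ha2 h₀ h₁ h₂)
  have hp : (1 : ℝ) ^ 2 = 1 := by norm_num
  have hn : (-1 : ℝ) ^ 2 = 1 := by norm_num
  -- At seven vertices `q₄ = ±1` and at `(-1, -1, -1, 1)` it is `-7`, so the bound summed over `i`
  -- is `7 * 7 - 49 = 0`: equality in Cauchy–Schwarz.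
  have hle : ∑ i, (quad (M i) (pt a (-1) 1 1) + quad (M i) (pt a (-1) (-1) 1)) ^ 2 ≤ 0 := by
    refine (Finset.sum_le_sum fun i _ =>
      sq_add_le_of_alternating _ _ _ _ _ _ _ _ (quad_cube (M i) a)).trans ?_
    simp only [Finset.sum_sub_distrib, ← Finset.mul_sum, Finset.sum_add_distrib]
    rw [hval hp hp hp, hval hn hp hp, hval hp hn hp, hval hp hp hn, hval hn hn hp, hval hn hp hn,
      hval hp hn hn, hval hn hn hn]
    norm_num
  have := (Finset.sum_eq_zero_iff_of_nonneg fun i _ => sq_nonneg _).1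
    (hle.antisymm (Finset.sum_nonneg fun i _ => sq_nonneg _)) i (Finset.mem_univ i)
  simpa using this

/-- Averaging the vertex relation over the zeros `a` and `-a` cancels the mixed `x`-`y` terms. The
right side no longer involves `a`, so the form takes one common value at all such zeros. -/
lemma quad_elim_zero_eq (hM : ∀ v : Vars → ℝ, aeval v hRat = ∑ i, quad (M i) v ^ 2)
    {a : Fin 4 → ℝ} (ha : fVal a = 0) (ha2 : a 2 ^ 2 = 1) (i : ι) :
    2 * quad (M i) (Sum.elim a 0)
      = -(quad (M i) (pt 0 (-1) 1 1) + quad (M i) (pt 0 (-1) (-1) 1)) := by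
  have hneg : fVal (-a) = 0 := by rw [← ha]; simp only [fVal, Pi.neg_apply]; ring
  have h₁ := quad_pt_add_quad_pt hM ha ha2 i
  have h₂ := quad_pt_add_quad_pt hM hneg (by simpa using ha2) i
  have hpar (e₀ e₁ e₂ : ℝ) : quad (M i) (pt a e₀ e₁ e₂) + quad (M i) (pt (-a) e₀ e₁ e₂)
      = 2 * quad (M i) (Sum.elim a 0) + 2 * quad (M i) (pt 0 e₀ e₁ e₂) := by
    have hq : quad (M i) (pt (-a) e₀ e₁ e₂) = quad (M i) (Sum.elim a 0 - pt 0 e₀ e₁ e₂) := by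
      have : Sum.elim a 0 - pt 0 e₀ e₁ e₂ = -pt (-a) e₀ e₁ e₂ := by
        funext j; cases j <;> simp [pt]
      rw [this]; simp [quad]
    have hq' : pt a e₀ e₁ e₂ = Sum.elim a 0 + pt 0 e₀ e₁ e₂ := by
      funext j; cases j <;> simp [pt]
    rw [hq, hq', quad_add_add_quad_sub]
  linarith [hpar (-1) 1 1, hpar (-1) (-1) 1]

/-- With `B = Q(u + w) - Q(u) - Q(w)`, one has `Q(u + w)² + Q(u - w)² = 2(Q(u) + Q(w))² + 2B²`; the
inequality drops the terms `2B²`. -/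
lemma four_mul_sum_quad_mul_quad_le
    (hM : ∀ v : Vars → ℝ, aeval v hRat = ∑ i, quad (M i) v ^ 2) (u w : Vars → ℝ) :
    4 * ∑ i, quad (M i) u * quad (M i) w
      ≤ aeval (u + w) hRat + aeval (u - w) hRat - 2 * aeval u hRat - 2 * aeval w hRat := by
  simp only [hM, Finset.mul_sum, ← Finset.sum_add_distrib, ← Finset.sum_sub_distrib]
  refine Finset.sum_le_sum fun i _ => ?_
  have h := quad_add_add_quad_sub (M i) u w
  have h' : quad (M i) (u - w) = 2 * quad (M i) u + 2 * quad (M i) w - quad (M i) (u + w) := by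
    linarith
  rw [h']
  nlinarith [sq_nonneg (quad (M i) (u + w) - quad (M i) u - quad (M i) w)]

end representation

/-! ### Irrationality -/

lemma rat_pow_three_ne_two (q : ℚ) : q ^ 3 ≠ 2 := by
  intro hq
  have hq' : (q : ℝ) ^ 3 = ((2 : ℤ) : ℝ) := by exact_mod_cast hq
  refine (irrational_nrt_of_notint_nrt 3 2 hq' ?_ (by norm_num)) ⟨q, rfl⟩
  rintro ⟨n, hn⟩
  rw [hn] at hq'
  have h : n ^ 3 = 2 := by exact_mod_cast hq'
  have hn0 : 0 ≤ n := by
    by_contra! hn0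
    nlinarith [pow_pos (neg_pos.2 hn0) 3]
  have h1 : 1 < n := lt_of_pow_lt_pow_left₀ 3 hn0 (by rw [h]; norm_num)
  nlinarith [pow_le_pow_left₀ (by norm_num) (Int.add_one_le_of_lt h1) 3]

lemma cbrtTwo_linearIndependent {a b c : ℚ} (h : (a : ℝ) + b * cbrtTwo + c * cbrtTwo ^ 2 = 0) :
    a = 0 ∧ b = 0 ∧ c = 0 := by
  have ht := cbrtTwo_pow_three
  -- Multiplying the relation by `c t - b` cancels its `t²` term and leaves a linear relation.
  have hlin : ((a * c - b ^ 2 : ℚ) : ℝ) * cbrtTwo + ((2 * c ^ 2 - a * b : ℚ) : ℝ) = 0 := by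
    push_cast
    linear_combination (c * cbrtTwo - b) * h - c ^ 2 * ht
  have h1 : a * c - b ^ 2 = 0 := by
    by_contra hne
    refine rat_pow_three_ne_two (-(2 * c ^ 2 - a * b) / (a * c - b ^ 2)) ?_
    have hne' : ((a * c - b ^ 2 : ℚ) : ℝ) ≠ 0 := by exact_mod_cast hne
    have : ((-(2 * c ^ 2 - a * b) / (a * c - b ^ 2) : ℚ) : ℝ) = cbrtTwo := by
      rw [Rat.cast_div, Rat.cast_neg, div_eq_iff hne']
      linarith
    rw [← this] at ht
    exact_mod_cast ht
  have h2 : 2 * c ^ 2 - a * b = 0 := by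
    rw [h1, Rat.cast_zero, zero_mul, zero_add] at hlin
    exact_mod_cast hlin
  have hc : c = 0 := by
    by_contra hc
    refine rat_pow_three_ne_two (b / c) ?_
    rw [div_pow, div_eq_iff (pow_ne_zero 3 hc)]
    -- From `ac = b²` and `ab = 2c²` follows `b³ = abc = 2c³`.
    linear_combination (-b) * h1 - c * h2
  subst hc
  have hb : b = 0 := by simpa using h1
  subst hb
  simpa using h

/-- The ternary quadratic form that the terms of `f` divisible by `x₀²` leave is psd only for an
irrational choice of the parameters. -/
lemma not_forall_ternary_nonneg (ξ τ : ℚ) :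
    ¬ ∀ a b c : ℝ, 0 ≤ ξ * a ^ 2 + 2 * τ * (a * b) + 4 * (a * c) + b ^ 2 + 2 * ξ * (b * c)
      + 2 * τ * c ^ 2 := by
  intro H
  have H' (a b c : ℚ) : 0 ≤ ξ * a ^ 2 + 2 * τ * (a * b) + 4 * (a * c) + b ^ 2 + 2 * ξ * (b * c)
      + 2 * τ * c ^ 2 := by exact_mod_cast H a b c
  -- The test vectors here and below extract the three principal 2×2 minors: `τ² ≤ ξ`, `ξ² ≤ 2τ` and
  -- `2 ≤ ξτ`. Multiplying the first two gives `ξτ ≤ 2`, so equality holds throughout.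
  have h1 : τ ^ 2 ≤ ξ := by nlinarith [H' 1 (-τ) 0]
  have h2 : ξ ^ 2 ≤ 2 * τ := by nlinarith [H' 0 (-ξ) 1]
  have hξ : 0 ≤ ξ := (sq_nonneg τ).trans h1
  have hτ : 0 ≤ τ := by linarith [sq_nonneg ξ]
  have hξ0 : 0 < ξ := by
    refine lt_of_le_of_ne hξ fun h0 => ?_
    have : τ = 0 := by
      rw [← h0] at h1
      exact pow_eq_zero_iff two_ne_zero |>.1 (h1.antisymm (sq_nonneg τ))
    have := H' 1 0 (-1)
    subst τ; linarith
  have h3 : 2 ≤ ξ * τ := by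
    have := H' (-2) 0 ξ
    nlinarith
  have h4 : ξ * τ ≤ 2 := by
    by_contra! h4
    have := mul_le_mul h2 h1 (sq_nonneg τ) (by linarith)
    nlinarith
  have h5 : ξ * τ = 2 := h4.antisymm h3
  have h6 : τ ^ 3 ≤ 2 := by nlinarith [mul_le_mul_of_nonneg_right h1 hτ]
  have h7 : ξ ^ 3 ≤ 4 := by nlinarith [mul_le_mul_of_nonneg_left h2 hξ]
  have h8 : ξ ^ 3 * τ ^ 3 = 8 := by rw [← mul_pow, h5]; norm_num
  refine rat_pow_three_ne_two τ (h6.antisymm ?_)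
  nlinarith [mul_le_mul_of_nonneg_right h7 (pow_nonneg hτ 3)]

/-! ### `h` is not a sum of squares over `ℚ` -/

lemma fVal_z : fVal ![0, 0, 1, 0] = 0 := by simp [fVal]

/-- On `x₀ = 0` the zeros of `f` are cut out by `x₁² + 2x₂x₃ = 0` and `x₁x₂ + x₃² = 0`; besides `(0,
0, 1, 0)`, this is a solution with `x₂ = 1`. -/
lemma fVal_u : fVal ![0, -cbrtTwo ^ 2, 1, -cbrtTwo] = 0 := by
  simp only [fVal, Matrix.cons_val]
  linear_combination (2 * cbrtTwo ^ 5 - 4 * cbrtTwo ^ 2) * cbrtTwo_pow_three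

section representation

variable {ι : Type*} [Fintype ι] {M : ι → Vars → Vars → ℚ}

lemma quad_hyperplane_eq (hM : ∀ v : Vars → ℝ, aeval v hRat = ∑ i, quad (M i) v ^ 2) (i : ι)
    (a b c : ℝ) :
    quad (M i) (Sum.elim ![0, a, b, c] 0)
      = M i (.inl 1) (.inl 1) * (a ^ 2 + 2 * b * c)
        + (M i (.inl 1) (.inl 2) + M i (.inl 2) (.inl 1) : ℚ) * (a * b + c ^ 2)
        + M i (.inl 2) (.inl 2) * b ^ 2 := by
  have hexp (a b c : ℝ) : quad (M i) (Sum.elim ![0, a, b, c] 0)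
      = M i (.inl 1) (.inl 1) * a ^ 2 + M i (.inl 2) (.inl 2) * b ^ 2
        + M i (.inl 3) (.inl 3) * c ^ 2
        + (M i (.inl 1) (.inl 2) + M i (.inl 2) (.inl 1)) * (a * b)
        + (M i (.inl 1) (.inl 3) + M i (.inl 3) (.inl 1)) * (a * c)
        + (M i (.inl 2) (.inl 3) + M i (.inl 3) (.inl 2)) * (b * c) := by
    simp only [quad, Fintype.sum_sum_type, Fin.sum_univ_four, Sum.elim_inl, Sum.elim_inr,
      Matrix.cons_val, Pi.zero_apply]
    ring
  have hz := quad_elim_zero_eq hM fVal_z (by simp) i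
  have hu := quad_elim_zero_eq hM fVal_u (by simp) i
  have huz := hu.trans hz.symm
  rw [hexp, hexp] at huz
  -- Equality of the values at the two zeros, reduced by `t³ = 2`, is a rational relation among `1,
  -- t, t²`; its three coefficients must vanish.
  obtain ⟨h1, h2, h3⟩ := cbrtTwo_linearIndependent
    (a := 2 * (M i (.inl 1) (.inl 3) + M i (.inl 3) (.inl 1)))
    (b := 2 * M i (.inl 1) (.inl 1) - (M i (.inl 2) (.inl 3) + M i (.inl 3) (.inl 2)))
    (c := M i (.inl 3) (.inl 3) - (M i (.inl 1) (.inl 2) + M i (.inl 2) (.inl 1))) (by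
      push_cast
      linear_combination huz / 2 - (M i (.inl 1) (.inl 1) * cbrtTwo
        + (M i (.inl 1) (.inl 3) + M i (.inl 3) (.inl 1))) * cbrtTwo_pow_three)
  have h1' := congrArg (Rat.cast (K := ℝ)) h1
  have h2' := congrArg (Rat.cast (K := ℝ)) h2
  have h3' := congrArg (Rat.cast (K := ℝ)) h3
  push_cast at h1' h2' h3'
  rw [hexp]
  push_cast
  linear_combination a * c / 2 * h1' - b * c * h2' + c ^ 2 * h3'

lemma not_forall_aeval_hRat_eq_sum_sq :
    ¬ ∀ v : Vars → ℝ, aeval v hRat = ∑ i, quad (M i) v ^ 2 := by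
  intro hM
  set u : Vars → ℝ := Sum.elim ![1, 0, 0, 0] 0 with hu
  have hquad_u (i : ι) : quad (M i) u = M i (.inl 0) (.inl 0) := by
    simp [quad, hu, Fintype.sum_sum_type, Fin.sum_univ_four]
  have hadd (a b : Fin 4 → ℝ) : u + Sum.elim a b = Sum.elim (![1, 0, 0, 0] + a) b := by
    rw [hu]; funext j; cases j <;> simp [-Matrix.cons_add, -Matrix.cons_sub]
  have hsub (a b : Fin 4 → ℝ) : u - Sum.elim a b = Sum.elim (![1, 0, 0, 0] - a) (-b) := by
    rw [hu]; funext j; cases j <;> simp [-Matrix.cons_add, -Matrix.cons_sub]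
  -- No monomial of `h` involves both `x₀` and a `y`-variable, so for these `w` the upper bound is
  -- 0. The two products add up to `-2` times the sum in question.
  have hD : 0 ≤ ∑ i, (M i (.inl 0) (.inl 0) : ℝ) * M i (.inl 2) (.inl 2) := by
    have h₁ := four_mul_sum_quad_mul_quad_le hM u (pt 0 (-1) 1 1)
    have h₂ := four_mul_sum_quad_mul_quad_le hM u (pt 0 (-1) (-1) 1)
    have hsum : ∑ i, quad (M i) u * quad (M i) (pt 0 (-1) 1 1)
        + ∑ i, quad (M i) u * quad (M i) (pt 0 (-1) (-1) 1)
        = -2 * ∑ i, (M i (.inl 0) (.inl 0) : ℝ) * M i (.inl 2) (.inl 2) := by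
      rw [← Finset.sum_add_distrib, Finset.mul_sum]
      refine Finset.sum_congr rfl fun i _ => ?_
      have hz := quad_elim_zero_eq hM fVal_z (by simp) i
      rw [quad_hyperplane_eq hM] at hz
      rw [hquad_u]
      linear_combination (M i (.inl 0) (.inl 0) : ℝ) * hz
    simp only [pt, hadd, hsub] at h₁ h₂ hsum
    rw [hu] at h₁ h₂ hsum
    simp only [aeval_hRat] at h₁ h₂
    simp [fVal, gVal] at h₁ h₂
    norm_num at h₁ h₂
    linarith
  -- `ξ` and `τ` come from dividing the inequality for `w = (0, a, b, c)` by 32. The leftover `b²`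
  -- term has the favourable sign by `hD` and can be dropped.
  refine not_forall_ternary_nonneg
    (1 / 2 - (∑ i, M i (.inl 0) (.inl 0) * M i (.inl 1) (.inl 1)) / 8)
    (1 - (∑ i, M i (.inl 0) (.inl 0) * (M i (.inl 1) (.inl 2) + M i (.inl 2) (.inl 1))) / 16)
    fun a b c => ?_
  have h := four_mul_sum_quad_mul_quad_le hM u (Sum.elim ![0, a, b, c] 0)
  have hsum : ∑ i, quad (M i) u * quad (M i) (Sum.elim ![0, a, b, c] 0)
      = (∑ i, (M i (.inl 0) (.inl 0) : ℝ) * M i (.inl 1) (.inl 1)) * (a ^ 2 + 2 * b * c)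
        + (∑ i, (M i (.inl 0) (.inl 0) : ℝ) * (M i (.inl 1) (.inl 2) + M i (.inl 2) (.inl 1)))
          * (a * b + c ^ 2)
        + (∑ i, (M i (.inl 0) (.inl 0) : ℝ) * M i (.inl 2) (.inl 2)) * b ^ 2 := by
    simp only [Finset.sum_mul, ← Finset.sum_add_distrib]
    refine Finset.sum_congr rfl fun i _ => ?_
    rw [quad_hyperplane_eq hM, hquad_u]
    push_cast
    ring
  rw [hsum, hadd, hsub, hu] at h
  simp only [aeval_hRat, fVal, gVal, Pi.add_apply, Pi.sub_apply, Pi.neg_apply, Pi.zero_apply,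
    Matrix.cons_val] at h
  push_cast
  nlinarith [mul_nonneg hD (sq_nonneg b)]

end representation

lemma not_isSumSq_hRat : ¬ IsSumSq hRat := by
  intro hsq
  obtain ⟨n, s, hs⟩ := hsq.exists_fin_sum
  choose M hM using fun i =>
    exists_aeval_eq_quad (homogeneousComponent_isHomogeneous 2 (s i))
  refine not_forall_aeval_hRat_eq_sum_sq (M := M) fun v => ?_
  conv_lhs => rw [eq_sum_sq_homogeneousComponent isHomogeneous_hRat hs]
  simp [hM]

end StrictlyPositiveSOS

theorem mainTheorem2 :
    -- `h` has rational coefficients: it is the image of the rational polynomial `hRat`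
    MvPolynomial.map (algebraMap ℚ StrictlyPositiveSOS.K) StrictlyPositiveSOS.hRat
        = StrictlyPositiveSOS.h ∧
    -- `h` is a quartic form
    StrictlyPositiveSOS.hRat.IsHomogeneous 4 ∧
    -- `h` is strictly positive: it is positive at every nonzero real point
    (∀ v : StrictlyPositiveSOS.Vars → ℝ, v ≠ 0 →
      0 < MvPolynomial.aeval v StrictlyPositiveSOS.hRat) ∧
    -- `h` is a sum of squares of polynomials over `ℚ(∛2)`
    IsSumSq StrictlyPositiveSOS.h ∧
    -- `h` is a sum of squares of polynomials over `ℝ`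
    IsSumSq (MvPolynomial.map (algebraMap ℚ ℝ) StrictlyPositiveSOS.hRat) ∧
    -- `h` is not a sum of squares of polynomials over `ℚ`
    ¬ IsSumSq StrictlyPositiveSOS.hRat :=
  ⟨StrictlyPositiveSOS.map_hRat, StrictlyPositiveSOS.isHomogeneous_hRat,
    fun _ hv => StrictlyPositiveSOS.aeval_hRat_pos hv, StrictlyPositiveSOS.isSumSq_h,
    StrictlyPositiveSOS.isSumSq_map_real, StrictlyPositiveSOS.not_isSumSq_hRat⟩
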